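/- Let $\varphi$ be Euler's totient function, let $V=\{\varphi(n): n\ge 1\}$, for $m\in V$ let $N_1(m)=\max\{x\ge 1:\varphi(x)\le m\}$, and let $N_1=\{N_1(m): m\in V\}$ be the set of sparsely totient numbers. For a prime $p$ and an integer $k\ge 1$ let $p_k$ denote the $k$-th smallest prime greater than $p$, and put $$Y_{p,k}=\prod_{\substack{q\le p_k,\ q\ \text{prime}\\ q\ne p}} q .$$ Let $p\ge 11$ be a prime. Then: (i) If $p$ and $p+2i$ are consecutive primes for some $i\in\{1,2,3,4\}$, then $Y_{p,2}\in N_1$. (ii) If $p$, $p+2$ and $p+6$ are consecutive primes, then $Y_{p,3}\in N_1$. (iii) Let $a,b$ be distinct positive even integers. If $p\ge 2ab$ and $p$, $p+a$, $p+b$ are consecutive primes (in some order), then $Y_{p,2}\in N_1$. -/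

import Mathlib

/-- The `i`-th smallest prime greater than `p`, for `i ≥ 1` (`Nat.nth` counts from `0`). -/
noncomputable def primeAfter (p i : ℕ) : ℕ :=
  Nat.nth (fun q => q.Prime ∧ p < q) (i - 1)

/-- `Y p k` is the product of all primes `q ∈ [2, p_k]` with `q ≠ p`, where `p_k` is the `k`-th
smallest prime greater than `p` (`k ≥ 1`). -/
noncomputable def Y (p k : ℕ) : ℕ :=
  ∏ q ∈ (Finset.Icc 2 (primeAfter p k)).filter (fun q => q.Prime ∧ q ≠ p), q

/-- The set of totients: the values of Euler's function at the positive integers. -/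
def totients : Set ℕ := {m | ∃ n : ℕ, 0 < n ∧ Nat.totient n = m}

/-- `IsN1 m N`: the positive integer `N` is the maximum of the positive integers `x` with
`φ(x) ≤ m`. -/
def IsN1 (m N : ℕ) : Prop := IsGreatest {x : ℕ | 0 < x ∧ Nat.totient x ≤ m} N

/-- The set `N₁` of sparsely totient numbers: the maxima `max {x : φ(x) ≤ m}`, as `m` runs over the
totients. -/
def sparselyTotient : Set ℕ := {N | ∃ m ∈ totients, IsN1 m N}

/-- The elements of `S` are consecutive primes: all of them are primes, and no prime lying between
two elements of `S` is missing from `S`. -/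
def ConsecutivePrimes (S : Set ℕ) : Prop :=
  (∀ q ∈ S, q.Prime) ∧ ∀ r ∈ S, ∀ s ∈ S, ∀ q : ℕ, q.Prime → r ≤ q → q ≤ s → q ∈ S

/-!
Let `N = Y p k` be the product of the primes up to `Q = p_k` other than `p`. It is sparsely totient
as soon as no `x > N` has `φ(x) ≤ φ(N)`. Such an `x` would have `x / φ(x) > N / φ(N)`, and
`x / φ(x)` is the product of `q / (q - 1)` over the primes `q ∣ x`. If `Q ≤ 2 p - 2`, this leaves
little room for `x` (`prod_primes_mem_sparselyTotient`): too many prime factors make `φ(x)` too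
large, too few of them, or a missing prime `ℓ ≤ p`, make `x / φ(x)` too small, and a repeated
factor again makes `φ(x)` too large. Each time the set of prime factors of `x` is compared with an
explicit set of primes by an exchange argument (`prod_le_prod_of_separated`). Hence `x` arises from
`N` by replacing the primes of `(p, Q]` by `p` and one fewer primes greater than `p`.

When `p + a`, `p + b` are replaced by `p` and `s`, the two inequalities and parity force
`s = p + a + b + 2 t` with `2 t (p - 1) ≤ a b < 2 t p` (`exists_of_swap`). This is impossible if
`a b < 2 (p - 1)`, which settles the case `2 a b ≤ p`. For three primes `p + 2`, `p + 6`, `p + b`,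
either one of `p + 2`, `p + 6` is kept, which leads back to two primes, or the totient is too large.

In the cases where the last prime `p + b` is not prescribed, `b` has to be bounded. Bertrand's
postulate is too weak for that; `exists_prime_lt_and_three_mul_lt` gives a prime between `n` and
roughly `4 n / 3`. It follows from Chebyshev's method with the quotient of factorials
`n! ⌊n/30⌋! / (⌊n/2⌋! ⌊n/3⌋! ⌊n/5⌋!)`, which bounds `ψ` between multiples of `n` whose
ratio is about `6 / 5`, and from a chain of explicit primes below a million. With `a ≤ 6` this
excludes all `t`; for `a = 8` the value `t = 1` remains, where `4 b = p - 1` and `3` divides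
`p (p + 8) (p + b)`. Primes `p < 37` are treated one by one: for `p = 13` and `p = 31` the
inequalities do have a solution, but then `s = 25` and `s = 49`.
-/

/-! ### Explicit bounds for factorials -/

/-- The logarithm lies below its tangent at `c`. -/
lemma log_le_div_add_log_sub_one {t c : ℝ} (ht : 0 < t) (hc : 0 < c) :
    Real.log t ≤ t / c + Real.log c - 1 := by
  have h := Real.log_le_sub_one_of_pos (div_pos ht hc)
  rw [Real.log_div ht.ne' hc.ne'] at h
  linarith

lemma log_factorial_le {m : ℕ} (hm : 1 ≤ m) :
    Real.log (m.factorial : ℝ) ≤ m * Real.log m - m + 1 + Real.log m := by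
  induction m, hm using Nat.le_induction with
  | base => simp
  | succ m hm ih =>
    have hm0 : (0 : ℝ) < m := by exact_mod_cast hm
    have h := Real.log_le_sub_one_of_pos (div_pos hm0 (by positivity : (0 : ℝ) < m + 1))
    rw [Real.log_div hm0.ne' (by positivity)] at h
    have h2 : (m + 1 : ℝ) * (m / (m + 1) - 1) = -1 := by field_simp; ring
    have h3 := mul_le_mul_of_nonneg_left h (by positivity : (0 : ℝ) ≤ m + 1)
    rw [h2] at h3
    rw [Nat.factorial_succ]
    push_cast
    rw [Real.log_mul (by positivity) (by positivity)]
    nlinarith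

/-- For `k ≤ n`, Stirling's main term at `n / k` bounds `log ⌊n / k⌋!` from below up to
`log (n / k)`. -/
lemma le_log_factorial_div {n k : ℕ} (hk : 0 < k) (hkn : k ≤ n) :
    (n / k : ℝ) * Real.log (n / k) - n / k - Real.log (n / k) ≤
      Real.log ((n / k).factorial : ℝ) := by
  have hm : 1 ≤ n / k := (Nat.one_le_div_iff hk).2 hkn
  have hk0 : (0 : ℝ) < k := by exact_mod_cast hk
  have hn0 : (0 : ℝ) < n := by exact_mod_cast (by omega : 0 < n)
  have hx : (1 : ℝ) ≤ n / k := by rw [le_div_iff₀ hk0]; simpa using hkn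
  have hlt : (n / k : ℝ) < ((n / k : ℕ) : ℝ) + 1 := by
    rw [div_lt_iff₀ hk0]
    have := Nat.lt_div_mul_add (a := n) hk
    have h2 : n < (n / k + 1) * k := by linarith
    exact_mod_cast h2
  set x : ℝ := n / k
  set m := n / k
  have hm0 : (1 : ℝ) ≤ m := by exact_mod_cast hm
  have h1 := Stirling.le_log_factorial_stirling (n := m) (by omega)
  have h2 : 0 ≤ Real.log (m : ℝ) := Real.log_nonneg hm0
  have h3 : 0 ≤ Real.log (2 * Real.pi) := Real.log_nonneg (by linarith [Real.pi_gt_three])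
  -- the tangent inequality `m log m - m ≥ m log x - x`
  have h4 : Real.log x ≤ x / m + Real.log m - 1 :=
    log_le_div_add_log_sub_one (by linarith) (by linarith)
  have h5 : (m : ℝ) * (x / m) = x := by field_simp
  have h6 := mul_le_mul_of_nonneg_left h4 (by linarith : (0 : ℝ) ≤ m)
  have h7 : 0 ≤ Real.log x := Real.log_nonneg hx
  nlinarith

/-- For `k ≤ n`, Stirling's main term at `n / k` bounds `log ⌊n / k⌋!` from above up to
`log (n / k) + 1`. -/
lemma log_factorial_div_le {n k : ℕ} (hk : 0 < k) (hkn : k ≤ n) :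
    Real.log ((n / k).factorial : ℝ) ≤
      (n / k : ℝ) * Real.log (n / k) - n / k + 1 + Real.log (n / k) := by
  have hm : 1 ≤ n / k := (Nat.one_le_div_iff hk).2 hkn
  have hmx : ((n / k : ℕ) : ℝ) ≤ (n / k : ℝ) := Nat.cast_div_le
  set x : ℝ := n / k
  set m := n / k
  have hm0 : (1 : ℝ) ≤ m := by exact_mod_cast hm
  have h1 := log_factorial_le hm
  have h2 : 0 ≤ Real.log (m : ℝ) := Real.log_nonneg hm0
  have h3 : Real.log (m : ℝ) ≤ Real.log x := Real.log_le_log (by linarith) hmx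
  -- the tangent inequality `x log x - x ≥ x log m - m`
  have h4 : Real.log m ≤ m / x + Real.log x - 1 :=
    log_le_div_add_log_sub_one (by linarith) (by linarith)
  have h5 : x * (m / x) = m := by have : x ≠ 0 := by linarith
                                  field_simp
  have h6 := mul_le_mul_of_nonneg_left h4 (by linarith : (0 : ℝ) ≤ x)
  nlinarith

/-! ### Chebyshev's bounds for `ψ` -/

lemma log_factorial_eq_sum_vonMangoldt (n : ℕ) :
    Real.log (n.factorial : ℝ) =
      ∑ d ∈ Finset.Ioc 0 n, ArithmeticFunction.vonMangoldt d * ((n / d : ℕ) : ℝ) := by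
  have h := ArithmeticFunction.sum_Ioc_mul_zeta_eq_sum ArithmeticFunction.vonMangoldt n
  rw [← h, ArithmeticFunction.vonMangoldt_mul_zeta]
  induction n with
  | zero => simp
  | succ n ih =>
    rw [Finset.sum_Ioc_succ_top (by omega), ← ih (by
      rw [ArithmeticFunction.sum_Ioc_mul_zeta_eq_sum]), Nat.factorial_succ]
    push_cast
    rw [Real.log_mul (by positivity) (by positivity), add_comm]
    simp [ArithmeticFunction.log_apply]

lemma log_factorial_div_eq_sum_vonMangoldt (n k : ℕ) :
    Real.log ((n / k).factorial : ℝ) =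
      ∑ d ∈ Finset.Ioc 0 n, ArithmeticFunction.vonMangoldt d * ((n / d / k : ℕ) : ℝ) := by
  rw [log_factorial_eq_sum_vonMangoldt]
  have hsub : Finset.Ioc 0 (n / k) ⊆ Finset.Ioc 0 n :=
    Finset.Ioc_subset_Ioc_right (Nat.div_le_self _ _)
  rw [← Finset.sum_subset hsub]
  · refine Finset.sum_congr rfl fun d _ => ?_
    rw [Nat.div_div_eq_div_mul, Nat.div_div_eq_div_mul, mul_comm k d]
  · intro d hd hd'
    simp only [Finset.mem_Ioc, not_and, not_le] at hd hd'
    have : n / d / k = 0 := by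
      rw [Nat.div_div_eq_div_mul, mul_comm, ← Nat.div_div_eq_div_mul]
      exact Nat.div_eq_of_lt (hd' hd.1)
    simp [this]

/-- The logarithm of Chebyshev's quotient of factorials, `n! ⌊n/30⌋! / (⌊n/2⌋! ⌊n/3⌋! ⌊n/5⌋!)`. -/
noncomputable def logChebyshevQuotient (n : ℕ) : ℝ :=
  Real.log (n.factorial : ℝ) - Real.log ((n / 2).factorial : ℝ)
    - Real.log ((n / 3).factorial : ℝ) - Real.log ((n / 5).factorial : ℝ)
    + Real.log ((n / 30).factorial : ℝ)

lemma logChebyshevQuotient_eq_sum (n : ℕ) :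
    logChebyshevQuotient n = ∑ d ∈ Finset.Ioc 0 n, ArithmeticFunction.vonMangoldt d *
      (((n / d : ℕ) : ℝ) - ((n / d / 2 : ℕ) : ℝ) - ((n / d / 3 : ℕ) : ℝ)
        - ((n / d / 5 : ℕ) : ℝ) + ((n / d / 30 : ℕ) : ℝ)) := by
  unfold logChebyshevQuotient
  rw [log_factorial_eq_sum_vonMangoldt n, log_factorial_div_eq_sum_vonMangoldt n 2,
    log_factorial_div_eq_sum_vonMangoldt n 3, log_factorial_div_eq_sum_vonMangoldt n 5,
    log_factorial_div_eq_sum_vonMangoldt n 30, ← Finset.sum_sub_distrib,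
    ← Finset.sum_sub_distrib, ← Finset.sum_sub_distrib, ← Finset.sum_add_distrib]
  exact Finset.sum_congr rfl fun d _ => by ring

/-- The coefficients of `Λ d` in Chebyshev's quotient are at most `1`. -/
lemma logChebyshevQuotient_le_psi (n : ℕ) : logChebyshevQuotient n ≤ Chebyshev.psi n := by
  rw [logChebyshevQuotient_eq_sum, Chebyshev.psi, Nat.floor_natCast]
  refine Finset.sum_le_sum fun d _ => ?_
  have h : n / d + n / d / 30 ≤ 1 + n / d / 2 + n / d / 3 + n / d / 5 := by omega
  have h' : ((n / d : ℕ) : ℝ) + ((n / d / 30 : ℕ) : ℝ) ≤ 1 + ((n / d / 2 : ℕ) : ℝ)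
      + ((n / d / 3 : ℕ) : ℝ) + ((n / d / 5 : ℕ) : ℝ) := by exact_mod_cast h
  exact mul_le_of_le_one_right ArithmeticFunction.vonMangoldt_nonneg (by linarith)

/-- The coefficients of `Λ d` in Chebyshev's quotient are nonnegative, and equal to `1` for
`n / 6 < d ≤ n`. -/
lemma psi_le_logChebyshevQuotient_add (n : ℕ) :
    Chebyshev.psi n ≤ logChebyshevQuotient n + Chebyshev.psi (n / 6 : ℕ) := by
  rw [logChebyshevQuotient_eq_sum, Chebyshev.psi, Chebyshev.psi, Nat.floor_natCast,
    Nat.floor_natCast]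
  have hsub : Finset.Ioc 0 (n / 6) ⊆ Finset.Ioc 0 n :=
    Finset.Ioc_subset_Ioc_right (Nat.div_le_self _ _)
  have hite : ∑ d ∈ Finset.Ioc 0 (n / 6), ArithmeticFunction.vonMangoldt d =
      ∑ d ∈ Finset.Ioc 0 n, if d ≤ n / 6 then ArithmeticFunction.vonMangoldt d else 0 := by
    rw [← Finset.sum_filter]
    refine Finset.sum_congr ?_ fun _ _ => rfl
    ext d
    simp only [Finset.mem_Ioc, Finset.mem_filter]
    have := Nat.div_le_self n 6
    omega
  rw [hite, ← Finset.sum_add_distrib]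
  refine Finset.sum_le_sum fun d hd => ?_
  rw [Finset.mem_Ioc] at hd
  have h0 := ArithmeticFunction.vonMangoldt_nonneg (n := d)
  have h : n / d / 2 + n / d / 3 + n / d / 5 ≤ n / d + n / d / 30 := by omega
  have h' : ((n / d / 2 : ℕ) : ℝ) + ((n / d / 3 : ℕ) : ℝ) + ((n / d / 5 : ℕ) : ℝ) ≤
      ((n / d : ℕ) : ℝ) + ((n / d / 30 : ℕ) : ℝ) := by exact_mod_cast h
  split_ifs with hd6
  · nlinarith
  · have h1 : 1 ≤ n / d := (Nat.one_le_div_iff hd.1).2 hd.2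
    have h6 : n / d < 6 := by
      rw [Nat.div_lt_iff_lt_mul hd.1]
      omega
    have h2 : 1 + n / d / 2 + n / d / 3 + n / d / 5 ≤ n / d + n / d / 30 := by omega
    have h2' : 1 + ((n / d / 2 : ℕ) : ℝ) + ((n / d / 3 : ℕ) : ℝ) + ((n / d / 5 : ℕ) : ℝ) ≤
        ((n / d : ℕ) : ℝ) + ((n / d / 30 : ℕ) : ℝ) := by exact_mod_cast h2
    nlinarith

/-- Chebyshev's constant `log (2 ^ (1/2) * 3 ^ (1/3) * 5 ^ (1/5) / 30 ^ (1/30)) = 0.9212…`. -/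
noncomputable def chebyshevConst : ℝ :=
  7 / 15 * Real.log 2 + 3 / 10 * Real.log 3 + 1 / 6 * Real.log 5

lemma chebyshevConst_bounds : 0.92 ≤ chebyshevConst ∧ chebyshevConst ≤ 0.922 := by
  have h2 := Real.log_two_gt_d9
  have h2' := Real.log_two_lt_d9
  have h3 := Real.log_three_gt_d9
  have h3' := Real.log_three_lt_d9
  have h5 := Real.log_five_gt_d9
  have h5' := Real.log_five_lt_d9
  unfold chebyshevConst
  constructor <;> norm_num at * <;> linarith

lemma logChebyshevQuotient_bounds {n : ℕ} (hn : 30 ≤ n) :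
    chebyshevConst * n - 5 * Real.log n - 3 ≤ logChebyshevQuotient n ∧
      logChebyshevQuotient n ≤ chebyshevConst * n + 5 * Real.log n + 2 := by
  have hn0 : (0 : ℝ) < n := by exact_mod_cast (by omega : 0 < n)
  have l1 := le_log_factorial_div (n := n) (k := 1) (by norm_num) (by omega)
  have u1 := log_factorial_div_le (n := n) (k := 1) (by norm_num) (by omega)
  have l2 := le_log_factorial_div (n := n) (k := 2) (by norm_num) (by omega)
  have u2 := log_factorial_div_le (n := n) (k := 2) (by norm_num) (by omega)
  have l3 := le_log_factorial_div (n := n) (k := 3) (by norm_num) (by omega)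
  have u3 := log_factorial_div_le (n := n) (k := 3) (by norm_num) (by omega)
  have l5 := le_log_factorial_div (n := n) (k := 5) (by norm_num) (by omega)
  have u5 := log_factorial_div_le (n := n) (k := 5) (by norm_num) (by omega)
  have l30 := le_log_factorial_div (n := n) (k := 30) (by norm_num) (by omega)
  have u30 := log_factorial_div_le (n := n) (k := 30) (by norm_num) (by omega)
  have h30 : Real.log 30 = Real.log 2 + Real.log 3 + Real.log 5 := by
    rw [← Real.log_mul (by norm_num) (by norm_num), ← Real.log_mul (by norm_num) (by norm_num)]
    norm_num
  push_cast at l1 u1 l2 u2 l3 u3 l5 u5 l30 u30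
  rw [Real.log_div hn0.ne' (by norm_num)] at l2 u2 l3 u3 l5 u5 l30 u30
  rw [h30] at l30 u30
  simp only [Nat.div_one, div_one] at l1 u1
  have p2 : 0 < Real.log 2 := Real.log_pos (by norm_num)
  have p3 : 0 < Real.log 3 := Real.log_pos (by norm_num)
  have p5 : 0 < Real.log 5 := Real.log_pos (by norm_num)
  unfold logChebyshevQuotient chebyshevConst
  constructor <;> nlinarith

lemma le_psi {n : ℕ} (hn : 30 ≤ n) : 0.92 * n - 5 * Real.log n - 3 ≤ Chebyshev.psi n := by
  have h1 := (logChebyshevQuotient_bounds hn).1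
  have h2 := logChebyshevQuotient_le_psi n
  have h3 := mul_le_mul_of_nonneg_right chebyshevConst_bounds.1 (Nat.cast_nonneg (α := ℝ) n)
  linarith

/-- Iterating `ψ n - ψ (n / 6) ≤ 0.922 n + O(log n)` gives the slope `6/5 * 0.922`, rounded up
to `1.15` so that the logarithmic terms are absorbed. -/
lemma psi_le_linear (n : ℕ) : Chebyshev.psi n ≤ 1.15 * n + 4000 := by
  induction n using Nat.strong_induction_on with
  | _ n ih =>
  rcases lt_or_ge n 2000 with hn | hn
  · rcases Nat.eq_zero_or_pos n with rfl | h0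
    · simp
    have hn1 : (1 : ℝ) ≤ n := by exact_mod_cast h0
    have hn2 : (n : ℝ) ≤ 2000 := by exact_mod_cast hn.le
    have h := Chebyshev.psi_le hn1
    have h4 : Real.log 4 = 2 * Real.log 2 := by
      rw [← Real.log_rpow (by norm_num)]; norm_num
    have hs : √(n : ℝ) ≤ 45 := Real.sqrt_le_iff.2 ⟨by norm_num, by linarith⟩
    have hl : Real.log n ≤ 8 := by
      have h1 : Real.log n ≤ Real.log ((2 : ℝ) ^ 11) :=
        Real.log_le_log (by linarith) (by norm_num; linarith)
      rw [Real.log_pow] at h1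
      have := Real.log_two_lt_d9
      push_cast at h1
      linarith
    have hl0 : 0 ≤ Real.log n := Real.log_nonneg hn1
    have h5 : √(n : ℝ) * Real.log n ≤ 45 * 8 := mul_le_mul hs hl hl0 (by norm_num)
    have h6 : Real.log 4 * n ≤ 1.4 * n := by
      refine mul_le_mul_of_nonneg_right ?_ (by linarith)
      have := Real.log_two_lt_d9
      rw [h4]; linarith
    linarith
  · have h1 := (logChebyshevQuotient_bounds (by omega : 30 ≤ n)).2
    have h2 := psi_le_logChebyshevQuotient_add n
    have h3 := mul_le_mul_of_nonneg_right chebyshevConst_bounds.2 (Nat.cast_nonneg (α := ℝ) n)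
    have h4 := ih (n / 6) (by omega)
    have h5 : ((n / 6 : ℕ) : ℝ) ≤ n / 6 := by exact_mod_cast Nat.cast_div_le (α := ℝ)
    have hn' : (2000 : ℝ) ≤ n := by exact_mod_cast hn
    have h6 := log_le_div_add_log_sub_one (by linarith : (0 : ℝ) < n)
      (by norm_num : (0 : ℝ) < (2 : ℝ) ^ 9)
    rw [Real.log_pow] at h6
    have := Real.log_two_lt_d9
    push_cast at h6
    linarith

lemma le_theta {n : ℕ} (hn : 30 ≤ n) : 0.89 * n - 13000 ≤ Chebyshev.theta n := by
  have hn' : (30 : ℝ) ≤ n := by exact_mod_cast hn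
  have h1 := le_psi hn
  have h2 := Chebyshev.psi_sub_theta_le (by linarith : (1 : ℝ) ≤ n)
  have hs0 : 0 < √(n : ℝ) := Real.sqrt_pos.2 (by linarith)
  have hsq : √(n : ℝ) * √(n : ℝ) = n := Real.mul_self_sqrt (by linarith)
  -- `log n = 2 log √n ≤ 2 (√n / 1024 + log 1024 - 1)`
  have h3 := log_le_div_add_log_sub_one hs0 (by norm_num : (0 : ℝ) < (2 : ℝ) ^ 10)
  rw [Real.log_sqrt (by linarith), Real.log_pow] at h3
  have := Real.log_two_lt_d9
  push_cast at h3
  have h4 : Real.log n ≤ √(n : ℝ) / 512 + 11.88 := by linarith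
  have h5 := mul_le_mul_of_nonneg_left h4 hs0.le
  have h6 : √(n : ℝ) ≤ n / 2048 + 512 := by nlinarith [sq_nonneg (√(n : ℝ) - 1024)]
  linarith

/-! ### Primes in short intervals -/

lemma exists_prime_of_large {n : ℕ} (hn : 1000000 ≤ n) :
    ∃ q : ℕ, q.Prime ∧ n < q ∧ 3 * q + 25 < 4 * n := by
  by_contra! hcon
  set y := (4 * n - 26) / 3 with hy
  have heq : Chebyshev.theta y = Chebyshev.theta n := by
    unfold Chebyshev.theta
    rw [Nat.floor_natCast, Nat.floor_natCast]
    refine Finset.sum_congr ?_ fun _ _ => rfl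
    ext q
    simp only [Finset.mem_filter, Finset.mem_Ioc]
    refine ⟨fun h => ⟨⟨h.1.1, ?_⟩, h.2⟩, fun h => ⟨⟨h.1.1, by omega⟩, h.2⟩⟩
    by_contra! hq
    have := hcon q h.2 hq
    omega
  have h1 := le_theta (n := y) (by omega)
  have h2 := psi_le_linear n
  have h3 := Chebyshev.theta_le_psi (n : ℝ)
  have h4 : (4 * n - 28 : ℝ) ≤ 3 * y := by
    have : 4 * n ≤ 3 * y + 28 := by omega
    have : (4 * n : ℝ) ≤ 3 * y + 28 := by exact_mod_cast this
    linarith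
  have hn' : (1000000 : ℝ) ≤ n := by exact_mod_cast hn
  linarith

/-- One link of a chain of primes reaching down from a range where the claim is known. -/
lemma exists_prime_of_chain {n : ℕ} (q : ℕ) {r : ℕ} (hr : r.Prime) (h : 3 * r + 25 < 4 * q)
    (H : n < q → ∃ s : ℕ, s.Prime ∧ n < s ∧ 3 * s + 25 < 4 * n) (hn : n < r) :
    ∃ s : ℕ, s.Prime ∧ n < s ∧ 3 * s + 25 < 4 * n := by
  rcases lt_or_ge n q with hq | hq
  · exact H hq
  · exact ⟨r, hr, hn, by omega⟩

/-- A sharpening of Bertrand's postulate by a factor of roughly `4/3`. -/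
theorem exists_prime_lt_and_three_mul_lt {n : ℕ} (hn : 38 ≤ n) :
    ∃ q : ℕ, q.Prime ∧ n < q ∧ 3 * q + 25 < 4 * n := by
  rcases lt_or_ge n 1277657 with h | h
  swap
  · exact exists_prime_of_large (by omega)
  revert h
  refine exists_prime_of_chain 958261 (r := 1277657) (by norm_num) (by norm_num) ?_
  refine exists_prime_of_chain 718717 (r := 958261) (by norm_num) (by norm_num) ?_
  refine exists_prime_of_chain 539047 (r := 718717) (by norm_num) (by norm_num) ?_
  refine exists_prime_of_chain 404323 (r := 539047) (by norm_num) (by norm_num) ?_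
  refine exists_prime_of_chain 303271 (r := 404323) (by norm_num) (by norm_num) ?_
  refine exists_prime_of_chain 227467 (r := 303271) (by norm_num) (by norm_num) ?_
  refine exists_prime_of_chain 170609 (r := 227467) (by norm_num) (by norm_num) ?_
  refine exists_prime_of_chain 127973 (r := 170609) (by norm_num) (by norm_num) ?_
  refine exists_prime_of_chain 95989 (r := 127973) (by norm_num) (by norm_num) ?_
  refine exists_prime_of_chain 71999 (r := 95989) (by norm_num) (by norm_num) ?_
  refine exists_prime_of_chain 54013 (r := 71999) (by norm_num) (by norm_num) ?_
  refine exists_prime_of_chain 40519 (r := 54013) (by norm_num) (by norm_num) ?_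
  refine exists_prime_of_chain 30403 (r := 40519) (by norm_num) (by norm_num) ?_
  refine exists_prime_of_chain 22817 (r := 30403) (by norm_num) (by norm_num) ?_
  refine exists_prime_of_chain 17123 (r := 22817) (by norm_num) (by norm_num) ?_
  refine exists_prime_of_chain 12853 (r := 17123) (by norm_num) (by norm_num) ?_
  refine exists_prime_of_chain 9661 (r := 12853) (by norm_num) (by norm_num) ?_
  refine exists_prime_of_chain 7253 (r := 9661) (by norm_num) (by norm_num) ?_
  refine exists_prime_of_chain 5449 (r := 7253) (by norm_num) (by norm_num) ?_
  refine exists_prime_of_chain 4099 (r := 5449) (by norm_num) (by norm_num) ?_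
  refine exists_prime_of_chain 3089 (r := 4099) (by norm_num) (by norm_num) ?_
  refine exists_prime_of_chain 2333 (r := 3089) (by norm_num) (by norm_num) ?_
  refine exists_prime_of_chain 1759 (r := 2333) (by norm_num) (by norm_num) ?_
  refine exists_prime_of_chain 1327 (r := 1759) (by norm_num) (by norm_num) ?_
  refine exists_prime_of_chain 1021 (r := 1327) (by norm_num) (by norm_num) ?_
  refine exists_prime_of_chain 773 (r := 1021) (by norm_num) (by norm_num) ?_
  refine exists_prime_of_chain 587 (r := 773) (by norm_num) (by norm_num) ?_
  refine exists_prime_of_chain 449 (r := 587) (by norm_num) (by norm_num) ?_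
  refine exists_prime_of_chain 349 (r := 449) (by norm_num) (by norm_num) ?_
  refine exists_prime_of_chain 271 (r := 349) (by norm_num) (by norm_num) ?_
  refine exists_prime_of_chain 211 (r := 271) (by norm_num) (by norm_num) ?_
  refine exists_prime_of_chain 173 (r := 211) (by norm_num) (by norm_num) ?_
  refine exists_prime_of_chain 139 (r := 173) (by norm_num) (by norm_num) ?_
  refine exists_prime_of_chain 113 (r := 139) (by norm_num) (by norm_num) ?_
  refine exists_prime_of_chain 101 (r := 113) (by norm_num) (by norm_num) ?_
  refine exists_prime_of_chain 83 (r := 101) (by norm_num) (by norm_num) ?_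
  refine exists_prime_of_chain 71 (r := 83) (by norm_num) (by norm_num) ?_
  refine exists_prime_of_chain 61 (r := 71) (by norm_num) (by norm_num) ?_
  refine exists_prime_of_chain 53 (r := 61) (by norm_num) (by norm_num) ?_
  refine exists_prime_of_chain 47 (r := 53) (by norm_num) (by norm_num) ?_
  refine exists_prime_of_chain 43 (r := 47) (by norm_num) (by norm_num) ?_
  refine exists_prime_of_chain 41 (r := 43) (by norm_num) (by norm_num) ?_
  refine exists_prime_of_chain 38 (r := 41) (by norm_num) (by norm_num) ?_
  intro h
  omega

/-! ### Exchanging prime factors -/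

/-- If `S` has at most as many elements as `A`, and the values of `f` on `S \ A` and on `A \ S` are
separated by some `c ≥ 1`, then `f` has the larger product on `A`. -/
lemma prod_le_prod_of_separated {S A : Finset ℕ} {f : ℕ → ℝ} {c : ℝ} (hc : 1 ≤ c)
    (hcard : S.card ≤ A.card) (hf : ∀ i ∈ S, 0 ≤ f i) (hS : ∀ i ∈ S, i ∉ A → f i ≤ c)
    (hA : ∀ i ∈ A, i ∉ S → c ≤ f i) : ∏ i ∈ S, f i ≤ ∏ i ∈ A, f i := by
  rw [← Finset.prod_inter_mul_prod_sdiff S A f, ← Finset.prod_inter_mul_prod_sdiff A S f,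
    Finset.inter_comm A S]
  have hcard' : (S \ A).card ≤ (A \ S).card := by
    have h1 := Finset.card_inter_add_card_sdiff S A
    have h2 := Finset.card_inter_add_card_sdiff A S
    rw [Finset.inter_comm] at h2
    omega
  refine mul_le_mul_of_nonneg_left ?_
    (Finset.prod_nonneg fun i hi => hf i (Finset.mem_inter.1 hi).1)
  calc ∏ i ∈ S \ A, f i ≤ ∏ _i ∈ S \ A, c :=
        Finset.prod_le_prod (fun i hi => hf i (Finset.mem_sdiff.1 hi).1)
          fun i hi => hS i (Finset.mem_sdiff.1 hi).1 (Finset.mem_sdiff.1 hi).2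
    _ = c ^ (S \ A).card := Finset.prod_const c
    _ ≤ c ^ (A \ S).card := pow_le_pow_right₀ hc hcard'
    _ = ∏ _i ∈ A \ S, c := (Finset.prod_const c).symm
    _ ≤ ∏ i ∈ A \ S, f i :=
        Finset.prod_le_prod (fun _ _ => by linarith)
          fun i hi => hA i (Finset.mem_sdiff.1 hi).1 (Finset.mem_sdiff.1 hi).2

/-- The factor `q / (q - 1)` that a prime `q ∣ x` contributes to `x / φ(x)`. -/
noncomputable def totientRatio (q : ℕ) : ℝ := q / (q - 1)

lemma totientRatio_le_of_le {a b : ℕ} (ha : 2 ≤ a) (hab : a ≤ b) :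
    totientRatio b ≤ totientRatio a := by
  have ha' : (2 : ℝ) ≤ a := by exact_mod_cast ha
  have hab' : (a : ℝ) ≤ b := by exact_mod_cast hab
  unfold totientRatio
  rw [div_le_div_iff₀ (by linarith) (by linarith)]
  linarith

lemma one_lt_totientRatio {a : ℕ} (ha : 2 ≤ a) : 1 < totientRatio a := by
  have ha' : (2 : ℝ) ≤ a := by exact_mod_cast ha
  unfold totientRatio
  rw [lt_div_iff₀ (by linarith)]
  linarith

/-- Two distinct primes up to `2 p - 2` contribute more to `x / φ(x)` than `p` alone. -/
lemma totientRatio_le_mul {p a b : ℕ} (ha : 2 ≤ a) (hab : a < b) (hb : b + 2 ≤ 2 * p) :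
    totientRatio p ≤ totientRatio a * totientRatio b := by
  have ha' : (2 : ℝ) ≤ a := by exact_mod_cast ha
  have hab' : (a + 1 : ℝ) ≤ b := by exact_mod_cast hab
  have hb' : (b + 2 : ℝ) ≤ 2 * p := by exact_mod_cast hb
  have h1 : totientRatio (b - 1) ≤ totientRatio a := totientRatio_le_of_le ha (by omega)
  have h2 : (b : ℝ) / (b - 2) ≤ totientRatio a * totientRatio b := by
    have h0 := one_lt_totientRatio (by omega : 2 ≤ b)
    refine le_trans (le_of_eq ?_) (mul_le_mul_of_nonneg_right h1 (by linarith))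
    unfold totientRatio
    have e1 : (b : ℝ) - 2 ≠ 0 := by linarith
    have e2 : (b : ℝ) - 1 ≠ 0 := by linarith
    rw [Nat.cast_sub (by omega), Nat.cast_one, show (b : ℝ) - 1 - 1 = b - 2 by ring]
    field_simp
  refine le_trans ?_ h2
  unfold totientRatio
  rw [div_le_div_iff₀ (by linarith) (by linarith)]
  nlinarith

lemma prod_sub_one_pos {S : Finset ℕ} (hS : ∀ q ∈ S, q.Prime) :
    0 < ∏ q ∈ S, ((q : ℝ) - 1) :=
  Finset.prod_pos fun q hq => by
    have : (2 : ℝ) ≤ q := by exact_mod_cast (hS q hq).two_le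
    linarith

lemma prod_totientRatio_pos {S : Finset ℕ} (hS : ∀ q ∈ S, q.Prime) :
    0 < ∏ q ∈ S, totientRatio q :=
  Finset.prod_pos fun q hq => lt_trans one_pos (one_lt_totientRatio (hS q hq).two_le)

lemma cast_totient_eq_div_mul {x : ℕ} :
    (x.totient : ℝ) = ((x / ∏ q ∈ x.primeFactors, q : ℕ) : ℝ) *
      ∏ q ∈ x.primeFactors, ((q : ℝ) - 1) := by
  rw [Nat.totient_eq_div_primeFactors_mul, Nat.cast_mul, Nat.cast_prod]
  congr 1
  refine Finset.prod_congr rfl fun q hq => ?_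
  rw [Nat.cast_sub (Nat.prime_of_mem_primeFactors hq).one_le, Nat.cast_one]

lemma cast_totient_prod_primes {A : Finset ℕ} (hA : ∀ q ∈ A, q.Prime) :
    ((∏ q ∈ A, q).totient : ℝ) = ∏ q ∈ A, ((q : ℝ) - 1) := by
  rw [cast_totient_eq_div_mul, Nat.primeFactors_prod hA,
    Nat.div_self (Finset.prod_pos fun q hq => (hA q hq).pos)]
  simp

/-! ### A criterion for products of primes to be sparsely totient -/

/-- Let `N` be the product of the primes up to `Q` other than `p`, where `p < Q ≤ 2 p - 2`. If
`x > N` and `φ(x) ≤ φ(N)`, then `x` is squarefree, it is divisible by all primes up to `p`, and it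
has as many prime factors as `N`. So `N` is sparsely totient as soon as the primes `U` in `(p, Q]`
cannot be replaced by `p` and `|U| - 1` primes `R` greater than `p` without decreasing the product
or increasing its totient. -/
theorem prod_primes_mem_sparselyTotient {p Q : ℕ} (hp : p.Prime) (hQ : Q.Prime) (hpQ : p < Q)
    (hQp : Q + 2 ≤ 2 * p)
    (H : ∀ R : Finset ℕ, (∀ q ∈ R, q.Prime ∧ p < q) →
      R.card + 1 = ((Finset.Ioc p Q).filter Nat.Prime).card →
      ∏ q ∈ (Finset.Ioc p Q).filter Nat.Prime, (q : ℝ) < p * ∏ q ∈ R, (q : ℝ) →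
      ∏ q ∈ (Finset.Ioc p Q).filter Nat.Prime, ((q : ℝ) - 1) <
        (p - 1) * ∏ q ∈ R, ((q : ℝ) - 1)) :
    ∏ q ∈ (Finset.Icc 2 Q).filter (fun q => q.Prime ∧ q ≠ p), q ∈ sparselyTotient := by
  set T := (Finset.Icc 2 Q).filter Nat.Prime with hT
  set U := (Finset.Ioc p Q).filter Nat.Prime with hU
  set L := (Finset.Icc 2 p).filter Nat.Prime with hL
  have hmemT : ∀ q, q ∈ T ↔ q ≤ Q ∧ q.Prime := fun q => by
    simp only [hT, Finset.mem_filter, Finset.mem_Icc]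
    exact ⟨fun h => ⟨h.1.2, h.2⟩, fun h => ⟨⟨h.2.two_le, h.1⟩, h.2⟩⟩
  have hTe : (Finset.Icc 2 Q).filter (fun q => q.Prime ∧ q ≠ p) = T.erase p := by
    ext q
    simp only [hT, Finset.mem_filter, Finset.mem_erase]
    tauto
  have hpT : p ∈ T := (hmemT p).2 ⟨hpQ.le, hp⟩
  have hQT : Q ∈ T := (hmemT Q).2 ⟨le_rfl, hQ⟩
  have hTprime : ∀ q ∈ T, q.Prime := fun q hq => ((hmemT q).1 hq).2
  have hNprime : ∀ q ∈ T.erase p, q.Prime := fun q hq => hTprime q (Finset.mem_of_mem_erase hq)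
  have hp3 : 3 ≤ p := by omega
  have hp3' : (3 : ℝ) ≤ p := by exact_mod_cast hp3
  have hQ' : (p : ℝ) < Q := by exact_mod_cast hpQ
  have hQp' : (Q : ℝ) + 2 ≤ 2 * p := by exact_mod_cast hQp
  rw [hTe]
  set N := ∏ q ∈ T.erase p, q with hN
  have hNpos : 0 < N := Finset.prod_pos fun q hq => (hNprime q hq).pos
  have hφN : (N.totient : ℝ) = ∏ q ∈ T.erase p, ((q : ℝ) - 1) :=
    cast_totient_prod_primes hNprime
  refine ⟨N.totient, ⟨N, hNpos, rfl⟩, ⟨hNpos, le_rfl⟩, ?_⟩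
  rintro x ⟨hx0, hx⟩
  by_contra! hlt
  set S := x.primeFactors with hS
  have hSprime : ∀ q ∈ S, q.Prime := fun q hq => Nat.prime_of_mem_primeFactors hq
  set c := x / ∏ q ∈ S, q with hc
  have hxc : x = c * ∏ q ∈ S, q := (Nat.div_mul_cancel (Nat.prod_primeFactors_dvd x)).symm
  have hc1 : 1 ≤ c := by
    by_contra! h
    rw [Nat.lt_one_iff.1 h, zero_mul] at hxc
    omega
  have hc1' : (1 : ℝ) ≤ c := by exact_mod_cast hc1
  have hφx : (x.totient : ℝ) = c * ∏ q ∈ S, ((q : ℝ) - 1) := cast_totient_eq_div_mul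
  have hx' : (c : ℝ) * ∏ q ∈ S, ((q : ℝ) - 1) ≤ ∏ q ∈ T.erase p, ((q : ℝ) - 1) := by
    rw [← hφx, ← hφN]; exact_mod_cast hx
  have hlt' : ∏ q ∈ T.erase p, (q : ℝ) < c * ∏ q ∈ S, (q : ℝ) := by
    have : (N : ℝ) < x := by exact_mod_cast hlt
    rw [hxc, hN] at this
    push_cast at this
    exact this
  have hSpos := prod_sub_one_pos hSprime
  have hTpos := prod_sub_one_pos hTprime
  have hNpos' := prod_sub_one_pos hNprime
  have hTp : ((p : ℝ) - 1) * ∏ q ∈ T.erase p, ((q : ℝ) - 1) = ∏ q ∈ T, ((q : ℝ) - 1) :=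
    Finset.mul_prod_erase T (fun q : ℕ => (q : ℝ) - 1) hpT
  -- `x / φ(x)` exceeds `N / φ(N)`
  have hratio : ∏ q ∈ T.erase p, totientRatio q < ∏ q ∈ S, totientRatio q := by
    unfold totientRatio
    rw [Finset.prod_div_distrib, Finset.prod_div_distrib, div_lt_div_iff₀ hNpos' hSpos]
    have h0 : 0 < ∏ q ∈ S, (q : ℝ) :=
      Finset.prod_pos fun q hq => by exact_mod_cast (hSprime q hq).pos
    have h1 := mul_lt_mul_of_pos_right hlt' hSpos
    have h2 := mul_le_mul_of_nonneg_left hx' h0.le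
    nlinarith
  -- If the primes of `T` outside `A` do not divide `x`, then the prime factors of `x` outside `A`
  -- exceed `Q`, so that exchanging them for elements of `A` increases `x / φ(x)`.
  have hexch : ∀ A ⊆ T, (∀ q ∈ T, q ∉ A → q ∉ S) → S.card ≤ A.card →
      ∏ q ∈ S, totientRatio q ≤ ∏ q ∈ A, totientRatio q := by
    intro A hAT hTA hcard
    refine prod_le_prod_of_separated (one_lt_totientRatio hQ.two_le).le hcard
      (fun q hq => (zero_lt_one.trans (one_lt_totientRatio (hSprime q hq).two_le)).le) ?_ ?_
    · intro q hq hqA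
      refine totientRatio_le_of_le hQ.two_le ?_
      by_contra! hqQ
      exact hTA q ((hmemT q).2 ⟨hqQ.le, hSprime q hq⟩) hqA hq
    · intro q hq _
      exact totientRatio_le_of_le (hTprime q (hAT hq)).two_le ((hmemT q).1 (hAT hq)).1
  have hTr : totientRatio p * ∏ q ∈ T.erase p, totientRatio q = ∏ q ∈ T, totientRatio q :=
    Finset.mul_prod_erase T totientRatio hpT
  have hNrpos := prod_totientRatio_pos hNprime
  -- `x` has fewer than `|T|` prime factors
  have hcard_lt : S.card < T.card := by
    by_contra! hcard
    have h : ∏ q ∈ T, ((q : ℝ) - 1) ≤ ∏ q ∈ S, ((q : ℝ) - 1) := by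
      refine prod_le_prod_of_separated (c := (Q : ℝ) - 1) (by linarith) hcard ?_ ?_ ?_
      · intro q hq
        have : (2 : ℝ) ≤ q := by exact_mod_cast (hTprime q hq).two_le
        linarith
      · intro q hq _
        have : (q : ℝ) ≤ Q := by exact_mod_cast ((hmemT q).1 hq).1
        linarith
      · intro q hq hqT
        have : Q < q := by
          by_contra! hqQ
          exact hqT ((hmemT q).2 ⟨hqQ, hSprime q hq⟩)
        have : (Q : ℝ) < q := by exact_mod_cast this
        linarith
    nlinarith
  -- and at least `|T| - 1`: otherwise two primes of `T` are missing
  have hcard : S.card + 1 = T.card := by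
    by_contra! hne
    have h2 : 1 < (T \ S).card := by
      have := Finset.le_card_sdiff S T
      omega
    obtain ⟨a, ha, b, hb, hab⟩ := Finset.one_lt_card.1 h2
    wlog hlt : a < b generalizing a b
    · exact this b hb a ha hab.symm (by omega)
    rw [Finset.mem_sdiff] at ha hb
    have haE : a ∈ T.erase b := Finset.mem_erase.2 ⟨hab, ha.1⟩
    have hle := hexch ((T.erase b).erase a)
      ((Finset.erase_subset _ _).trans (Finset.erase_subset _ _)) (by
        intro q hq hqA
        simp only [Finset.mem_erase, not_and] at hqA
        by_cases hqa : q = a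
        · rw [hqa]; exact ha.2
        · by_cases hqb : q = b
          · rw [hqb]; exact hb.2
          · exact absurd hq (hqA hqa hqb)) (by
        rw [Finset.card_erase_of_mem haE, Finset.card_erase_of_mem hb.1]
        omega)
    have e1 := Finset.mul_prod_erase (T.erase b) totientRatio haE
    have e2 := Finset.mul_prod_erase T totientRatio hb.1
    have hr := totientRatio_le_mul (p := p) (hTprime a ha.1).two_le hlt
      (by have := ((hmemT b).1 hb.1).1; omega)
    have hpos : 0 < ∏ q ∈ (T.erase b).erase a, totientRatio q := prod_totientRatio_pos
      fun q hq => hTprime q (Finset.mem_of_mem_erase (Finset.mem_of_mem_erase hq))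
    have hp1 := one_lt_totientRatio hp.two_le
    have h3 : ∏ q ∈ T.erase p, totientRatio q < ∏ q ∈ (T.erase b).erase a, totientRatio q :=
      hratio.trans_le hle
    have h4 : totientRatio p * ∏ q ∈ T.erase p, totientRatio q =
        (totientRatio a * totientRatio b) * ∏ q ∈ (T.erase b).erase a, totientRatio q := by
      rw [hTr, ← e2, ← e1]; ring
    have h5 := mul_le_mul_of_nonneg_right hr hpos.le
    have h6 := mul_lt_mul_of_pos_left h3 (by linarith : 0 < totientRatio p)
    linarith
  -- every prime up to `p` divides `x`
  have hLS : ∀ q ∈ T, q ≤ p → q ∈ S := by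
    intro a ha hap
    by_contra haS
    have hle := hexch (T.erase a) (Finset.erase_subset _ _) (by
        intro q hq hqA
        have : q = a := by
          by_contra hqa
          exact hqA (Finset.mem_erase.2 ⟨hqa, hq⟩)
        rw [this]; exact haS) (by
        rw [Finset.card_erase_of_mem ha]
        omega)
    have e := Finset.mul_prod_erase T totientRatio ha
    have hr := totientRatio_le_of_le (hTprime a ha).two_le hap
    have h3 := hratio.trans_le hle
    have hp1 := one_lt_totientRatio hp.two_le
    have h4 := mul_lt_mul_of_pos_left h3 (by linarith : 0 < totientRatio p)
    have h5 := mul_le_mul_of_nonneg_right hr (hNrpos.trans h3).le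
    linarith
  -- `x` is squarefree, as `2 (p - 1) > Q - 1`
  have hc_eq : c = 1 := by
    by_contra! hne
    have hc2 : (2 : ℝ) ≤ c := by exact_mod_cast (by omega : 2 ≤ c)
    have h : ∏ q ∈ T.erase Q, ((q : ℝ) - 1) ≤ ∏ q ∈ S, ((q : ℝ) - 1) := by
      refine prod_le_prod_of_separated (c := (Q : ℝ) - 1) (by linarith)
        (by rw [Finset.card_erase_of_mem hQT]; omega) ?_ ?_ ?_
      · intro q hq
        have : (2 : ℝ) ≤ q := by exact_mod_cast (hTprime q (Finset.mem_of_mem_erase hq)).two_le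
        linarith
      · intro q hq _
        have : (q : ℝ) ≤ Q := by
          exact_mod_cast ((hmemT q).1 (Finset.mem_of_mem_erase hq)).1
        linarith
      · intro q hq hqT
        have : Q ≤ q := by
          by_contra! hqQ
          exact hqT (Finset.mem_erase.2 ⟨hqQ.ne, (hmemT q).2 ⟨hqQ.le, hSprime q hq⟩⟩)
        have : (Q : ℝ) ≤ q := by exact_mod_cast this
        linarith
    have e : ((Q : ℝ) - 1) * ∏ q ∈ T.erase Q, ((q : ℝ) - 1) = ∏ q ∈ T, ((q : ℝ) - 1) :=
      Finset.mul_prod_erase T (fun q : ℕ => (q : ℝ) - 1) hQT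
    have hQpos : 0 < ∏ q ∈ T.erase Q, ((q : ℝ) - 1) :=
      prod_sub_one_pos fun q hq => hTprime q (Finset.mem_of_mem_erase hq)
    have h1 : 2 * ∏ q ∈ T.erase Q, ((q : ℝ) - 1) ≤ ∏ q ∈ T.erase p, ((q : ℝ) - 1) := by
      nlinarith
    have h2 := mul_le_mul_of_nonneg_left h1 (by linarith : (0 : ℝ) ≤ p - 1)
    nlinarith
  -- split off the primes up to `p`
  have hdisjU : Disjoint L U := by
    rw [Finset.disjoint_left]
    intro q hq hq'
    simp only [hL, hU, Finset.mem_filter, Finset.mem_Icc, Finset.mem_Ioc] at hq hq'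
    omega
  have hTLU : T = L ∪ U := by
    ext q
    simp only [hT, hL, hU, Finset.mem_union, Finset.mem_filter, Finset.mem_Icc, Finset.mem_Ioc]
    by_cases hq : q.Prime
    · have := hq.two_le
      simp only [hq, and_true]
      omega
    · simp [hq]
  set R := S.filter (fun q => p < q) with hR
  have hdisjR : Disjoint L R := by
    rw [Finset.disjoint_left]
    intro q hq hq'
    simp only [hL, hR, Finset.mem_filter, Finset.mem_Icc] at hq hq'
    omega
  have hSLR : S = L ∪ R := by
    ext q
    simp only [hL, hR, Finset.mem_union, Finset.mem_filter, Finset.mem_Icc]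
    constructor
    · intro hq
      rcases le_or_gt q p with h | h
      · exact Or.inl ⟨⟨(hSprime q hq).two_le, h⟩, hSprime q hq⟩
      · exact Or.inr ⟨hq, h⟩
    · rintro (h | h)
      · exact hLS q ((hmemT q).2 ⟨h.1.2.trans hpQ.le, h.2⟩) h.1.2
      · exact h.1
  have hLprime : ∀ q ∈ L, q.Prime := fun q hq => (Finset.mem_filter.1 hq).2
  have hLpos := prod_sub_one_pos hLprime
  have hLpos' : 0 < ∏ q ∈ L, (q : ℝ) :=
    Finset.prod_pos fun q hq => by exact_mod_cast (hLprime q hq).pos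
  rw [hc_eq, Nat.cast_one, one_mul] at hx' hlt'
  have hTp' : (p : ℝ) * ∏ q ∈ T.erase p, (q : ℝ) = ∏ q ∈ T, (q : ℝ) :=
    Finset.mul_prod_erase T (fun q : ℕ => (q : ℝ)) hpT
  have hH := H R (fun q hq => ⟨hSprime q (Finset.mem_filter.1 hq).1, (Finset.mem_filter.1 hq).2⟩)
    (by
      rw [hTLU, hSLR, Finset.card_union_of_disjoint hdisjU,
        Finset.card_union_of_disjoint hdisjR] at hcard
      omega)
    (by
      have h := mul_lt_mul_of_pos_left hlt' (by linarith : (0 : ℝ) < p)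
      rw [hTp', hTLU, hSLR, Finset.prod_union hdisjU, Finset.prod_union hdisjR] at h
      refine lt_of_mul_lt_mul_left (lt_of_lt_of_eq h ?_) hLpos'.le
      ring)
  have h := mul_le_mul_of_nonneg_left hx' (by linarith : (0 : ℝ) ≤ p - 1)
  rw [hTp, hTLU, hSLR, Finset.prod_union hdisjU, Finset.prod_union hdisjR] at h
  have h' := mul_lt_mul_of_pos_left hH hLpos
  linarith

/-! ### Two or three primes above `p` -/

/-- If there are `k` primes in `(p, q]` and `q` is one of them, then `p_k = q`. -/
lemma primeAfter_eq {p k q : ℕ} (hq : q.Prime) (hpq : p < q)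
    (hk : ((Finset.Ioc p q).filter Nat.Prime).card = k) : primeAfter p k = q := by
  classical
  have hcount : Nat.count (fun r => r.Prime ∧ p < r) q = k - 1 := by
    rw [Nat.count_eq_card_filter_range, ← hk,
      ← Finset.card_erase_of_mem (a := q) (by simp [hq, hpq])]
    congr 1
    ext r
    simp only [Finset.mem_filter, Finset.mem_range, Finset.mem_erase, Finset.mem_Ioc]
    constructor
    · rintro ⟨h1, h2, h3⟩
      exact ⟨h1.ne, ⟨h3, h1.le⟩, h2⟩
    · rintro ⟨h1, ⟨h2, h3⟩, h4⟩
      exact ⟨by omega, h4, h2⟩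
  unfold primeAfter
  rw [← hcount]
  exact Nat.nth_count (p := fun r => r.Prime ∧ p < r) ⟨hq, hpq⟩

lemma Y_eq_prod {p k q : ℕ} (hq : q.Prime) (hpq : p < q)
    (hk : ((Finset.Ioc p q).filter Nat.Prime).card = k) :
    Y p k = ∏ r ∈ (Finset.Icc 2 q).filter (fun r => r.Prime ∧ r ≠ p), r := by
  rw [Y, primeAfter_eq hq hpq hk]

/-- If `p + a` and `p + b` can be replaced by `p` and `s`, increasing the product but not the
product of the predecessors, then `s = p + a + b + 2 t` with `a b` in the short interval
`[2 t (p - 1), 2 t p)`. -/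
lemma exists_of_swap {p a b s : ℕ} (hp : Odd p) (hs : Odd s) (ha : Even a) (hb : Even b)
    (h1 : ((p : ℤ) + a) * (p + b) < p * s)
    (h2 : ((p : ℤ) - 1) * (s - 1) ≤ (p + a - 1) * (p + b - 1)) :
    ∃ t : ℕ, 0 < t ∧ s = p + a + b + 2 * t ∧ 2 * t * p ≤ a * b + 2 * t ∧ a * b < 2 * t * p := by
  have hlt : p + a + b < s := by
    by_contra! h
    have h' : (s : ℤ) ≤ p + a + b := by exact_mod_cast h
    nlinarith [mul_le_mul_of_nonneg_left h' (Int.natCast_nonneg p),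
      mul_nonneg (Int.natCast_nonneg a) (Int.natCast_nonneg b)]
  obtain ⟨t, ht⟩ : Even (s - (p + a + b)) :=
    Nat.Odd.sub_odd hs ((hp.add_even ha).add_even hb)
  have hst : s = p + a + b + 2 * t := by omega
  refine ⟨t, by omega, hst, ?_, ?_⟩
  · zify
    rw [hst] at h2
    push_cast at h2
    linarith
  · zify
    rw [hst] at h1
    push_cast at h1
    linarith

/-- The criterion for two primes `p + a < p + b` following `p`. -/
lemma Y_two_mem_sparselyTotient {p a b : ℕ} (hp : p.Prime) (ha0 : 0 < a) (hab : a < b)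
    (ha : Even a) (hb : Even b) (hbp : b + 2 ≤ p) (hpa : (p + a).Prime) (hpb : (p + b).Prime)
    (hgap : ∀ q, q.Prime → p < q → q ≤ p + b → q = p + a ∨ q = p + b)
    (H : ∀ t, 0 < t → 2 * t * p ≤ a * b + 2 * t → a * b < 2 * t * p →
      ¬ (p + a + b + 2 * t).Prime) : Y p 2 ∈ sparselyTotient := by
  have hU : (Finset.Ioc p (p + b)).filter Nat.Prime = {p + a, p + b} := by
    ext q
    simp only [Finset.mem_filter, Finset.mem_Ioc, Finset.mem_insert, Finset.mem_singleton]
    refine ⟨fun h => hgap q h.2 h.1.1 h.1.2, ?_⟩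
    rintro (rfl | rfl)
    · exact ⟨by omega, hpa⟩
    · exact ⟨by omega, hpb⟩
  have hne : p + a ≠ p + b := by omega
  rw [Y_eq_prod hpb (by omega) (by rw [hU, Finset.card_pair hne])]
  refine prod_primes_mem_sparselyTotient hp hpb (by omega) (by omega) ?_
  rw [hU, Finset.prod_pair hne, Finset.prod_pair hne, Finset.card_pair hne]
  intro R hR hcard hlt
  obtain ⟨s, rfl⟩ := Finset.card_eq_one.1 (by omega : R.card = 1)
  obtain ⟨hs, hps⟩ := hR s (Finset.mem_singleton_self s)
  rw [Finset.prod_singleton] at hlt ⊢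
  by_contra! hle
  push_cast at hlt hle
  obtain ⟨t, ht0, rfl, ht1, ht2⟩ := exists_of_swap (hp.odd_of_ne_two (by omega))
    (hs.odd_of_ne_two (by omega)) ha hb (by exact_mod_cast hlt) (by exact_mod_cast hle)
  exact H t ht0 ht1 ht2 hs

/-- The criterion for primes `p + 2 < p + 6 < p + b` following `p`. If one of `p + 2`, `p + 6` is
kept, the other and `p + b` are replaced by `p` and a single prime; otherwise both new primes are
at least `p + b`, which makes the totient too large. -/
lemma Y_three_mem_sparselyTotient {p b : ℕ} (hp : p.Prime) (hp11 : 11 ≤ p) (hb6 : 6 < b)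
    (hbp : b + 2 ≤ p) (hp2 : (p + 2).Prime) (hp6 : (p + 6).Prime) (hpb : (p + b).Prime)
    (hgap : ∀ q, q.Prime → p < q → q ≤ p + b → q = p + 2 ∨ q = p + 6 ∨ q = p + b)
    (H : ∀ t, 0 < t → 2 * t * p ≤ 6 * b + 2 * t → ¬ 6 * b < 2 * t * p) :
    Y p 3 ∈ sparselyTotient := by
  have hpodd := hp.odd_of_ne_two (by omega)
  have hb : Even b := by
    have := hpb.odd_of_ne_two (by omega)
    rw [Nat.odd_add] at this
    exact this.1 hpodd
  have hU : (Finset.Ioc p (p + b)).filter Nat.Prime = {p + 2, p + 6, p + b} := by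
    ext q
    simp only [Finset.mem_filter, Finset.mem_Ioc, Finset.mem_insert, Finset.mem_singleton]
    refine ⟨fun h => hgap q h.2 h.1.1 h.1.2, ?_⟩
    rintro (rfl | rfl | rfl)
    · exact ⟨by omega, hp2⟩
    · exact ⟨by omega, hp6⟩
    · exact ⟨by omega, hpb⟩
  have h26 : p + 2 ∉ ({p + 6, p + b} : Finset ℕ) := by
    simp only [Finset.mem_insert, Finset.mem_singleton]; omega
  have h6b : p + 6 ≠ p + b := by omega
  have hUcard : ({p + 2, p + 6, p + b} : Finset ℕ).card = 3 := by
    rw [Finset.card_insert_of_notMem h26, Finset.card_pair h6b]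
  rw [Y_eq_prod hpb (by omega) (by rw [hU, hUcard])]
  refine prod_primes_mem_sparselyTotient hp hpb (by omega) (by omega) ?_
  rw [hU, hUcard, Finset.prod_insert h26, Finset.prod_insert h26, Finset.prod_pair h6b,
    Finset.prod_pair h6b]
  intro R hR hcard hlt
  obtain ⟨s, u, hsu, rfl⟩ := Finset.card_eq_two.1 (by omega : R.card = 2)
  rw [Finset.prod_pair hsu] at hlt ⊢
  wlog hsu' : s < u generalizing s u
  · rw [mul_comm ((s : ℝ) - 1)]
    rw [mul_comm (s : ℝ)] at hlt
    rw [Finset.pair_comm] at hR hcard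
    exact this u s hsu.symm hR hcard hlt (by omega)
  obtain ⟨hs, hps⟩ := hR s (by simp)
  obtain ⟨hu, hpu⟩ := hR u (by simp)
  have hsodd := hs.odd_of_ne_two (by omega)
  have huodd := hu.odd_of_ne_two (by omega)
  by_contra! hle
  push_cast at hlt hle
  have hlt' : ((p : ℤ) + 2) * ((p + 6) * (p + b)) < p * (s * u) := by exact_mod_cast hlt
  have hle' : ((p : ℤ) - 1) * ((s - 1) * (u - 1)) ≤
    (p + 2 - 1) * ((p + 6 - 1) * (p + b - 1)) := by exact_mod_cast hle
  have hp' : (11 : ℤ) ≤ p := by exact_mod_cast hp11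
  have hb' : (6 : ℤ) < b := by exact_mod_cast hb6
  have hcases : s = p + 2 ∨ s = p + 6 ∨ p + b ≤ s := by
    rcases le_or_gt s (p + b) with h | h
    · rcases hgap s hs hps h with h | h | h <;> omega
    · omega
  rcases hcases with rfl | rfl | hsb
  · push_cast at hlt' hle'
    obtain ⟨t, ht0, -, ht1, ht2⟩ := exists_of_swap (a := 6) hpodd huodd (by decide) hb
      (by push_cast; exact lt_of_mul_lt_mul_left
            (by linarith : ((p : ℤ) + 2) * ((p + 6) * (p + b)) < (p + 2) * (p * u)) (by linarith))
      (by push_cast; exact le_of_mul_le_mul_left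
            (by linarith : ((p : ℤ) + 2 - 1) * ((p - 1) * (u - 1)) ≤
              (p + 2 - 1) * ((p + 6 - 1) * (p + b - 1))) (by linarith))
    exact H t ht0 ht1 ht2
  · push_cast at hlt' hle'
    obtain ⟨t, ht0, -, ht1, -⟩ := exists_of_swap (a := 2) hpodd huodd (by decide) hb
      (by push_cast; exact lt_of_mul_lt_mul_left
            (by linarith : ((p : ℤ) + 6) * ((p + 2) * (p + b)) < (p + 6) * (p * u)) (by linarith))
      (by push_cast; exact le_of_mul_le_mul_left
            (by linarith : ((p : ℤ) + 6 - 1) * ((p - 1) * (u - 1)) ≤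
              (p + 6 - 1) * ((p + 2 - 1) * (p + b - 1))) (by linarith))
    nlinarith
  · have hsb' : (p : ℤ) + b ≤ s := by exact_mod_cast hsb
    -- `b` is even and the primes `s < u` are odd, so `u ≥ p + 10`
    have hu10 : (p : ℤ) + 10 ≤ u := by
      obtain ⟨b', rfl⟩ := hb
      obtain ⟨s', rfl⟩ := hsodd
      obtain ⟨u', rfl⟩ := huodd
      obtain ⟨p', rfl⟩ := hpodd
      have : 2 * p' + 1 + 10 ≤ 2 * u' + 1 := by omega
      exact_mod_cast this
    have h1 : ((s : ℤ) - 1) * ((p - 1) * (p + 9)) ≤ (s - 1) * ((p - 1) * (u - 1)) := by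
      refine mul_le_mul_of_nonneg_left ?_ (by linarith)
      exact mul_le_mul_of_nonneg_left (by linarith) (by linarith)
    have h2 : ((p : ℤ) + b - 1) * ((p + 1) * (p + 5)) ≤ (s - 1) * ((p + 1) * (p + 5)) :=
      mul_le_mul_of_nonneg_right (by linarith) (by nlinarith)
    have h3 : (p : ℤ) * p + 8 * p - 9 ≤ p * p + 6 * p + 5 := by
      refine le_of_mul_le_mul_left (a := (s : ℤ) - 1) ?_ (by linarith)
      linarith
    linarith

/-! ### The prime following a given number -/

lemma exists_next_prime (n : ℕ) :
    ∃ q : ℕ, q.Prime ∧ n < q ∧ ∀ r : ℕ, r.Prime → n < r → q ≤ r := by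
  classical
  have h : ∃ q : ℕ, q.Prime ∧ n < q := by
    obtain ⟨q, hq, hq'⟩ := Nat.exists_infinite_primes (n + 1)
    exact ⟨q, hq', hq⟩
  exact ⟨Nat.find h, (Nat.find_spec h).1, (Nat.find_spec h).2,
    fun r hr hnr => Nat.find_min' h ⟨hr, hnr⟩⟩

lemma prime_gap_cases {p i : ℕ} (hp : p.Prime) (hp11 : 11 ≤ p) (hp37 : p < 37) (hi : 1 ≤ i)
    (hpi : (p + 2 * i).Prime) (hgap : ∀ q, q.Prime → p < q → p + 2 * i ≤ q) :
    p = 11 ∧ i = 1 ∨ p = 13 ∧ i = 2 ∨ p = 17 ∧ i = 1 ∨ p = 19 ∧ i = 2 ∨ p = 23 ∧ i = 3 ∨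
      p = 29 ∧ i = 1 ∨ p = 31 ∧ i = 3 := by
  have h13 := hgap 13 (by norm_num)
  have h17 := hgap 17 (by norm_num)
  have h19 := hgap 19 (by norm_num)
  have h23 := hgap 23 (by norm_num)
  have h29 := hgap 29 (by norm_num)
  have h31 := hgap 31 (by norm_num)
  have h37 := hgap 37 (by norm_num)
  interval_cases p <;> try (exfalso; revert hp; norm_num; done)
  all_goals
    have hi3 : i ≤ 3 := by omega
    interval_cases i <;> first | omega | (exfalso; revert hpi; norm_num)

/-- The case of the theorem in which `p` and `p + 2 i` are consecutive primes. For `p ≥ 37` the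
next prime `p + b` has `3 b < p + 8 i - 25`. -/
lemma Y_two_mem_of_gap {p i : ℕ} (hp : p.Prime) (hp11 : 11 ≤ p) (hi1 : 1 ≤ i) (hi4 : i ≤ 4)
    (hpi : (p + 2 * i).Prime) (hgap : ∀ q, q.Prime → p < q → p + 2 * i ≤ q) :
    Y p 2 ∈ sparselyTotient := by
  obtain ⟨Q, hQ, hpQ, hmin⟩ := exists_next_prime (p + 2 * i)
  obtain ⟨b, rfl⟩ : ∃ b, Q = p + b := ⟨Q - p, by omega⟩
  have hb : Even b := by
    have := hQ.odd_of_ne_two (by omega)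
    rw [Nat.odd_add] at this
    exact this.1 (hp.odd_of_ne_two (by omega))
  have hgap' : ∀ q, q.Prime → p < q → q ≤ p + b → q = p + 2 * i ∨ q = p + b := by
    intro q hq hpq hqb
    have h1 := hgap q hq hpq
    rcases h1.eq_or_lt with h | h
    · exact Or.inl h.symm
    · exact Or.inr (le_antisymm hqb (hmin q hq h))
  rcases lt_or_ge p 37 with hp37 | hp37
  · have hb0 : b % 2 = 0 := Nat.even_iff.1 hb
    rcases prime_gap_cases hp hp11 hp37 hi1 hpi hgap with
      ⟨rfl, rfl⟩ | ⟨rfl, rfl⟩ | ⟨rfl, rfl⟩ | ⟨rfl, rfl⟩ | ⟨rfl, rfl⟩ | ⟨rfl, rfl⟩ | ⟨rfl, rfl⟩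
    · have := hmin 17 (by norm_num) (by norm_num)
      exact Y_two_mem_sparselyTotient hp (by omega) (by omega) (by decide) hb (by omega) hpi hQ
        hgap' (by intro t; omega)
    · have := hmin 19 (by norm_num) (by norm_num)
      refine Y_two_mem_sparselyTotient hp (by omega) (by omega) (by decide) hb (by omega) hpi hQ
        hgap' fun t _ _ _ => ?_
      -- the only candidate is `25`
      rw [show 13 + 2 * 2 + b + 2 * t = 25 by omega]
      norm_num
    · have := hmin 23 (by norm_num) (by norm_num)
      exact Y_two_mem_sparselyTotient hp (by omega) (by omega) (by decide) hb (by omega) hpi hQ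
        hgap' (by intro t; omega)
    · have := hmin 29 (by norm_num) (by norm_num)
      refine Y_two_mem_sparselyTotient hp (by omega) (by omega) (by decide) hb (by omega) hpi hQ
        hgap' fun t _ _ => ?_
      rcases (by omega : b = 6 ∨ b = 8 ∨ b = 10) with rfl | rfl | rfl <;> omega
    · have := hmin 31 (by norm_num) (by norm_num)
      exact Y_two_mem_sparselyTotient hp (by omega) (by omega) (by decide) hb (by omega) hpi hQ
        hgap' (by intro t; omega)
    · have := hmin 37 (by norm_num) (by norm_num)
      exact Y_two_mem_sparselyTotient hp (by omega) (by omega) (by decide) hb (by omega) hpi hQ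
        hgap' (by intro t; omega)
    · have := hmin 41 (by norm_num) (by norm_num)
      refine Y_two_mem_sparselyTotient hp (by omega) (by omega) (by decide) hb (by omega) hpi hQ
        hgap' fun t _ _ _ => ?_
      -- the only candidate is `49`
      rw [show 31 + 2 * 3 + b + 2 * t = 49 by omega]
      norm_num
  · obtain ⟨r, hr, hnr, hrb⟩ := exists_prime_lt_and_three_mul_lt (by omega : 38 ≤ p + 2 * i)
    have hle := hmin r hr hnr
    refine Y_two_mem_sparselyTotient hp (by omega) (by omega) ⟨i, by ring⟩ hb (by omega) hpi hQ
      hgap' fun t ht0 ht1 ht2 => ?_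
    exfalso
    have h3 : ∀ q : ℕ, q.Prime → 3 < q → q % 3 ≠ 0 := fun q hq h hq0 => by
      have := (Nat.prime_dvd_prime_iff_eq Nat.prime_three hq).1 (Nat.dvd_of_mod_eq_zero hq0)
      omega
    have h3p := h3 p hp (by omega)
    have h3i := h3 _ hpi (by omega)
    have h3b := h3 _ hQ (by omega)
    obtain ⟨p', hp'⟩ := hp.odd_of_ne_two (by omega)
    rcases (by omega : t = 1 ∨ 2 ≤ t) with rfl | ht
    · -- only `i = 4` and `4 b = p - 1` is possible, and then `3 ∣ p + b`
      rcases (by omega : b % 3 = 0 ∨ b % 3 = 1 ∨ b % 3 = 2) with h | h | h <;>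
        interval_cases i <;> omega
    · have : 2 * 2 * (p - 1) ≤ 2 * t * (p - 1) := Nat.mul_le_mul_right _ (by omega)
      have : 2 * t * (p - 1) = 2 * t * p - 2 * t := by rw [Nat.mul_sub, mul_one]
      interval_cases i <;> omega

lemma Y_three_mem_of_gap {p : ℕ} (hp : p.Prime) (hp11 : 11 ≤ p) (hp2 : (p + 2).Prime)
    (hp6 : (p + 6).Prime) (hgap : ∀ q, q.Prime → p < q → q ≤ p + 6 → q = p + 2 ∨ q = p + 6) :
    Y p 3 ∈ sparselyTotient := by
  obtain ⟨Q, hQ, hpQ, hmin⟩ := exists_next_prime (p + 6)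
  obtain ⟨b, rfl⟩ : ∃ b, Q = p + b := ⟨Q - p, by omega⟩
  have hb0 : b % 2 = 0 := by
    have := hQ.odd_of_ne_two (by omega)
    rw [Nat.odd_add] at this
    exact Nat.even_iff.1 (this.1 (hp.odd_of_ne_two (by omega)))
  have hgap' : ∀ q, q.Prime → p < q → q ≤ p + b → q = p + 2 ∨ q = p + 6 ∨ q = p + b := by
    intro q hq hpq hqb
    rcases le_or_gt q (p + 6) with h | h
    · have := hgap q hq hpq h
      omega
    · exact Or.inr (Or.inr (le_antisymm hqb (hmin q hq h)))
  rcases lt_or_ge p 37 with hp37 | hp37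
  · have hcases := prime_gap_cases (i := 1) hp hp11 hp37 le_rfl hp2 fun q hq hpq => by
      rcases le_or_gt q (p + 6) with h | h
      · have := hgap q hq hpq h
        omega
      · omega
    obtain rfl | rfl | rfl : p = 11 ∨ p = 17 ∨ p = 29 := by omega
    · have := hmin 19 (by norm_num) (by norm_num)
      exact Y_three_mem_sparselyTotient hp (by omega) (by omega) (by omega) hp2 hp6 hQ hgap'
        (by intro t; omega)
    · have := hmin 29 (by norm_num) (by norm_num)
      refine Y_three_mem_sparselyTotient hp (by omega) (by omega) (by omega) hp2 hp6 hQ hgap'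
        fun t _ _ => ?_
      rcases (by omega : b = 8 ∨ b = 10 ∨ b = 12) with rfl | rfl | rfl <;> omega
    · norm_num at hp6
  · obtain ⟨r, hr, hnr, hrb⟩ := exists_prime_lt_and_three_mul_lt (by omega : 38 ≤ p + 6)
    have hle := hmin r hr hnr
    refine Y_three_mem_sparselyTotient hp hp11 (by omega) (by omega) hp2 hp6 hQ hgap'
      fun t ht0 ht1 => ?_
    have : 2 * 1 * (p - 1) ≤ 2 * t * (p - 1) := Nat.mul_le_mul_right _ (by omega)
    have : 2 * t * (p - 1) = 2 * t * p - 2 * t := by rw [Nat.mul_sub, mul_one]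
    omega

theorem theorem3 (p : ℕ) (hp : p.Prime) (hp11 : 11 ≤ p) :
    (∀ i ∈ Finset.Icc 1 4, ConsecutivePrimes {p, p + 2 * i} → Y p 2 ∈ sparselyTotient) ∧
    (ConsecutivePrimes {p, p + 2, p + 6} → Y p 3 ∈ sparselyTotient) ∧
    (∀ a b : ℕ, 0 < a → 0 < b → Even a → Even b → a ≠ b → 2 * a * b ≤ p →
      ConsecutivePrimes {p, p + a, p + b} → Y p 2 ∈ sparselyTotient) := by
  refine ⟨fun i hi h => ?_, fun h => ?_, fun a b ha0 hb0 ha hb hab habp h => ?_⟩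
  · rw [Finset.mem_Icc] at hi
    refine Y_two_mem_of_gap hp hp11 hi.1 hi.2 (h.1 _ (by simp)) fun q hq hpq => ?_
    by_contra! hlt
    have := h.2 p (by simp) (p + 2 * i) (by simp) q hq hpq.le hlt.le
    simp only [Set.mem_insert_iff, Set.mem_singleton_iff] at this
    omega
  · refine Y_three_mem_of_gap hp hp11 (h.1 _ (by simp)) (h.1 _ (by simp)) fun q hq hpq hq6 => ?_
    have := h.2 p (by simp) (p + 6) (by simp) q hq hpq.le hq6
    simp only [Set.mem_insert_iff, Set.mem_singleton_iff] at this
    omega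
  · wlog hlt : a < b generalizing a b
    · exact this b a hb0 ha0 hb ha hab.symm (by linarith)
        (by rwa [Set.pair_comm]) (by omega)
    have ha2 : 2 ≤ a := by
      obtain ⟨k, rfl⟩ := ha
      omega
    have hb4 : 4 * b ≤ p := by nlinarith
    refine Y_two_mem_sparselyTotient hp ha0 hlt ha hb (by omega) (h.1 _ (by simp))
      (h.1 _ (by simp)) (fun q hq hpq hqb => ?_) fun t ht0 ht1 _ => ?_
    · have := h.2 p (by simp) (p + b) (by simp) q hq hpq.le hqb
      simp only [Set.mem_insert_iff, Set.mem_singleton_iff] at this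
      omega
    · have : 2 * 1 * (p - 1) ≤ 2 * t * (p - 1) := Nat.mul_le_mul_right _ (by omega)
      have : 2 * t * (p - 1) = 2 * t * p - 2 * t := by rw [Nat.mul_sub, mul_one]
      have : 2 * a * b = 2 * (a * b) := by ring
      omega
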